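/- For $p\in\mathbb N$ write $[p]=\{1,\dots,p\}$, and for $X\in\mathbb R^{p\times p}$ let $\|X\|_1=\sum_{i,j}|X_{ij}|$. A set $\Omega\subseteq[p]\times[p]$ is called $d$-distributed if it has at most $d$ elements in each row and at most $d$ elements in each column; $\mathfrak W_{d,p}$ is the family of all such sets, and $X_\Omega$ is the matrix that agrees with $X$ on $\Omega$ and vanishes off $\Omega$. A random $\delta$-left regular bipartite graph on $([p],[m])$ is obtained by choosing, for each $i\in[p]$, $\delta$ right endpoints in $[m]$ uniformly and independently, with replacement; its adjacency matrix is an $m\times p$ matrix, which may be taken either as the $0$-$1$ matrix (repeated edges merged) or with multiplicities (repeated edges counted). For $A,B\in\mathbb R^{m\times p}$ and $X\in\mathbb R^{p\times p}$ consider the program $$(P_1)\qquad \min_{\tilde X\in\mathbb R^{p\times p}}\ \|\tilde X\|_1\quad\text{subject to}\quad A\tilde XB^T=AXB^T .$$ **Theorem.** There are constants $\alpha_0>0$, $c>0$ and $\epsilon\in(0,1/4)$ such that for every $\alpha\ge\alpha_0$ there is a $\beta>0$ with the following property. Let $p\ge2$, $d\ge1$, and let $\delta,m\in\mathbb N$ satisfy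 $$\alpha_0\log p\le\delta\le\alpha\log p,\qquad m\ge\beta\sqrt{dp}\,\log p .$$ Let $X$ be an arbitrary real $p\times p$ matrix, and let $A,B$ be the adjacency matrices (both $0$-$1$, or both with multiplicities) of two independent random $\delta$-left regular bipartite graphs on $([p],[m])$. Then with probability exceeding $1-p^{-c}$ the program $(P_1)$ has a solution, and every solution $X^\ast$ of it satisfies $$\|X^\ast-X\|_1\ \le\ \frac{2-4\epsilon}{1-4\epsilon}\ \min_{\Omega\in\mathfrak W_{d,p}}\|X-X_\Omega\|_1 .$$ The same holds when $B=A$ is the adjacency matrix of a single random $\delta$-left regular bipartite graph. -/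

import Mathlib

open MeasureTheory ProbabilityTheory
open scoped Matrix

noncomputable section

/-- The entrywise `ℓ₁` norm `∑ i j, |X i j|` of a matrix. -/
def entryNorm {p : ℕ} (X : Matrix (Fin p) (Fin p) ℝ) : ℝ :=
  ∑ i, ∑ j, |X i j|

/-- The family of `d`-distributed subsets of `[p] × [p]`: at most `d` elements in each row and
at most `d` elements in each column. -/
def distributedSets (d p : ℕ) : Finset (Finset (Fin p × Fin p)) :=
  {W | ∀ k : Fin p, (W.filter fun x => x.1 = k).card ≤ d ∧ (W.filter fun x => x.2 = k).card ≤ d}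

theorem distributedSets_nonempty (d p : ℕ) : (distributedSets d p).Nonempty :=
  ⟨∅, by simp [distributedSets]⟩

/-- The projection `X_W` of `X` onto the matrices supported on `W`. -/
def restrictTo {p : ℕ} (W : Finset (Fin p × Fin p)) (X : Matrix (Fin p) (Fin p) ℝ) :
    Matrix (Fin p) (Fin p) ℝ :=
  Matrix.of fun i j => if (i, j) ∈ W then X i j else 0

/-- The error `min_W ‖X - X_W‖₁` of the best `d`-distributed sparse approximation of `X`, the
minimum being over all `d`-distributed sets `W`. -/
def bestDistributedError {p : ℕ} (d : ℕ) (X : Matrix (Fin p) (Fin p) ℝ) : ℝ :=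
  (distributedSets d p).inf' (distributedSets_nonempty d p)
    fun W => entryNorm (X - restrictTo W X)

/-- `Z` is an optimal solution of the program: minimize `‖X'‖₁` subject to `A X' Bᵀ = Y`. -/
def IsL1Solution {m p : ℕ} (A B : Matrix (Fin m) (Fin p) ℝ) (Y : Matrix (Fin m) (Fin m) ℝ)
    (Z : Matrix (Fin p) (Fin p) ℝ) : Prop :=
  A * Z * Bᵀ = Y ∧ ∀ X' : Matrix (Fin p) (Fin p) ℝ, A * X' * Bᵀ = Y → entryNorm Z ≤ entryNorm X'

/-- The outcomes of the sampling of a random left regular bipartite graph: `E i k` is the right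
endpoint in `[m]` of the `k`-th of the `δ` edges at the left vertex `i ∈ [p]`. -/
abbrev EdgeChoice (p δ m : ℕ) : Type := Fin p → Fin δ → Fin m

/-- All the edges are drawn uniformly and independently, with replacement. -/
def edgeLaw (p δ m : ℕ) : Measure (EdgeChoice p δ m) := uniformOn Set.univ

/-- The 0-1 adjacency matrix, where repeated edges are merged. -/
def simpleAdj {p δ m : ℕ} (E : EdgeChoice p δ m) : Matrix (Fin m) (Fin p) ℝ :=
  Matrix.of fun j i => if ∃ k, E i k = j then 1 else 0

/-- The adjacency matrix of the multigraph, where repeated edges are counted. -/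
def multiAdj {p δ m : ℕ} (E : EdgeChoice p δ m) : Matrix (Fin m) (Fin p) ℝ :=
  Matrix.of fun j i => ((Finset.univ.filter fun k => E i k = j).card : ℝ)

/-- The program with data `Y = A X Bᵀ` is solvable, and each of its solutions approximates `X` as
well as the best `d`-distributed sparse approximation does, up to `(2 - 4ε) / (1 - 4ε)`. -/
def ApproximatelyRecovers {m p : ℕ} (ε : ℝ) (d : ℕ) (A B : Matrix (Fin m) (Fin p) ℝ)
    (X : Matrix (Fin p) (Fin p) ℝ) : Prop :=
  (∃ Z, IsL1Solution A B (A * X * Bᵀ) Z) ∧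
    ∀ Z, IsL1Solution A B (A * X * Bᵀ) Z →
      entryNorm (Z - X) ≤ (2 - 4 * ε) / (1 - 4 * ε) * bestDistributedError d X

end

/-! The constraint says that `X`, read as a vector indexed by `[p] × [p]`, is measured by the
product matrix with entries `A j i * B j' i'`. Since `X` is given before the graphs are drawn, it
suffices to treat one set `Ω`, a minimizer of `‖X - X_Ω‖₁`. The deterministic half of the argument
is a null space property for this `Ω`: every kernel vector has at most half as much mass on `Ω` as
off it. This gives the error factor 6, which is `(2 - 4ε) / (1 - 4ε)` at `ε = 1/5`. By
`two_mul_sum_abs_le_of_collision_le`, the property holds once every column of the product matrix, of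
mass about `δ²`, has only a small fraction of its mass in rows met by other columns from `Ω`.

The probabilistic half bounds these collisions at a vertex `(a, b)`. A colliding pair from `Ω` in
the same column or the same row forces an edge at `a` or at `b` into the neighborhood of about `d`
vertices, which is sparse in `[m]`. The other pairs of `Ω`, at most `dp` in number, cover at most
`dp δ²` of the `m²` right vertices of the product. By averaging, few `j` have a dense fiber in this
set, so few edges at `a` end at such `j`; over each remaining `j` the fiber is sparse, so few edges
at `b` end in it. This is where `m` of order `√(dp) log p` suffices.

Each bad event maps at least `δ/64` edges into a set of density at most `2^(-192)` that does not
depend on them, and so has probability at most `4^(-δ)`. A union bound over `δ + 5` events at each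
of `p²` vertices leaves less than `1/p`. Both sampling models are treated at once, with vertices in
a type `V` and embeddings `u`, `v` of `[p]`: disjoint copies for independent graphs, the identity
twice for a single graph. In the latter case coincidences among `a`, `b` and the vertices of `Ω`
need separate care. -/

/-! ### Many coordinates rarely fall into a sparse set -/

/-- If `H E` does not depend on the coordinates in `T` and has density at most `1 / K`, then the
proportion of the functions `E` mapping all of `T` into `H E` is at most `K ^ (-|T|)`. -/
theorem pow_card_mul_card_forall_mem_le {ι : Type*} [Fintype ι] [DecidableEq ι] {m K : ℕ}
    (T : Finset ι) (H : (ι → Fin m) → Finset (Fin m))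
    (hH : ∀ E E' : ι → Fin m, (∀ s, s ∉ T → E s = E' s) → H E = H E')
    (hK : ∀ E, K * (H E).card ≤ m) :
    K ^ T.card * (Finset.univ.filter fun E : ι → Fin m => ∀ t ∈ T, E t ∈ H E).card
      ≤ Fintype.card (ι → Fin m) := by
  classical
  induction T using Finset.induction_on with
  | empty => simp
  | insert t T ht ih =>
    have ih := ih fun E E' h => hH E E' fun s hs => h s fun hs' => hs (Finset.mem_insert_of_mem hs')
    set F := Finset.univ.filter fun E : ι → Fin m => ∀ s ∈ insert t T, E s ∈ H E with hF
    set F' := Finset.univ.filter fun E : ι → Fin m => ∀ s ∈ T, E s ∈ H E with hF'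
    have hup : ∀ E j, H (Function.update E t j) = H E := fun E j =>
      hH _ _ fun s hs => Function.update_of_ne (by rintro rfl; simp at hs) _ _
    -- Resampling coordinate `t` while recording its old value is injective. It leaves `H`
    -- unchanged, and the recorded value lies in `H`.
    have key : (F ×ˢ (Finset.univ : Finset (Fin m))).card ≤ (F'.sigma fun E => H E).card := by
      refine Finset.card_le_card_of_injOn
        (fun x => ⟨Function.update x.1 t x.2, x.1 t⟩) ?_ ?_
      · rintro ⟨E, j⟩ hE
        simp only [hF, Finset.coe_product, Set.mem_prod, Finset.mem_coe, Finset.mem_filter,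
          Finset.mem_univ, true_and, and_true] at hE
        simp only [Finset.mem_coe, Finset.mem_sigma, hF', Finset.mem_filter, Finset.mem_univ,
          true_and, hup]
        refine ⟨fun s hs => ?_, hE t (Finset.mem_insert_self _ _)⟩
        rw [Function.update_of_ne (by rintro rfl; exact ht hs)]
        exact hE s (Finset.mem_insert_of_mem hs)
      · rintro ⟨E, j⟩ - ⟨E', j'⟩ - h
        simp only [Sigma.mk.injEq, heq_eq_eq] at h
        obtain ⟨h1, h2⟩ := h
        have hj : j = j' := by simpa using congrFun h1 t
        have hE : E = E' := by
          funext s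
          by_cases hs : s = t
          · rw [hs, h2]
          · simpa [Function.update_of_ne hs] using congrFun h1 s
        rw [hE, hj]
    rw [Finset.card_product, Finset.card_univ, Fintype.card_fin, Finset.card_sigma] at key
    have h2 : K * F.card * m ≤ F'.card * m := by
      calc K * F.card * m = K * (F.card * m) := by ring
        _ ≤ K * ∑ E ∈ F', (H E).card := Nat.mul_le_mul_left _ key
        _ = ∑ E ∈ F', K * (H E).card := Finset.mul_sum _ _ _
        _ ≤ ∑ _E ∈ F', m := Finset.sum_le_sum fun E _ => hK E
        _ = F'.card * m := by simp
    have h3 : K * F.card ≤ F'.card := by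
      rcases Nat.eq_zero_or_pos m with rfl | hm
      · have : F = ∅ := Finset.eq_empty_of_forall_notMem fun E _ => (E t).elim0
        simp [this]
      · exact Nat.le_of_mul_le_mul_right h2 hm
    rw [Finset.card_insert_of_notMem ht]
    calc K ^ (T.card + 1) * F.card = K ^ T.card * (K * F.card) := by ring
      _ ≤ K ^ T.card * F'.card := Nat.mul_le_mul_left _ h3
      _ ≤ _ := ih

/-- A union bound over the possible sets of coordinates that are mapped into a sparse set. -/
theorem four_pow_mul_card_filter_le {ι : Type*} [Fintype ι] [DecidableEq ι] {m δ n : ℕ}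
    (J : Finset ι) (hJ : J.card ≤ δ) (H : Finset ι → (ι → Fin m) → Finset (Fin m))
    (hH : ∀ T, T ⊆ J → ∀ E E' : ι → Fin m, (∀ s, s ∉ T → E s = E' s) → H T E = H T E')
    (hK : ∀ T E, 2 ^ (3 * n) * (H T E).card ≤ m)
    (P : (ι → Fin m) → Prop) [DecidablePred P]
    (hP : ∀ E, P E → ∃ T, T ⊆ J ∧ δ ≤ n * T.card ∧ ∀ t ∈ T, E t ∈ H T E) :
    4 ^ δ * (Finset.univ.filter P).card ≤ Fintype.card (ι → Fin m) := by
  classical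
  set N := Fintype.card (ι → Fin m)
  let 𝒯 := J.powerset.filter fun T => δ ≤ n * T.card
  have hsub : Finset.univ.filter P ⊆
      𝒯.biUnion fun T => Finset.univ.filter fun E : ι → Fin m => ∀ t ∈ T, E t ∈ H T E := by
    intro E hE
    obtain ⟨T, hT, hc, h⟩ := hP E (by simpa using hE)
    simp only [Finset.mem_biUnion]
    exact ⟨T, by simp [𝒯, hT, hc], by simpa using h⟩
  have h𝒯 : 𝒯.card ≤ 2 ^ δ :=
    (Finset.card_filter_le _ _).trans
      ((Finset.card_powerset J).le.trans (Nat.pow_le_pow_right two_pos hJ))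
  -- Each `T` has proportion at most `2^(-3n|T|) ≤ 2^(-3δ)`, and there are at most `2^δ` sets `T`,
  -- which leaves `4^(-δ)`.
  have h1 : 2 ^ (3 * δ) * (Finset.univ.filter P).card ≤ 2 ^ δ * N := by
    calc 2 ^ (3 * δ) * (Finset.univ.filter P).card
        ≤ 2 ^ (3 * δ) * ∑ T ∈ 𝒯,
            (Finset.univ.filter fun E : ι → Fin m => ∀ t ∈ T, E t ∈ H T E).card :=
          Nat.mul_le_mul_left _ ((Finset.card_le_card hsub).trans Finset.card_biUnion_le)
      _ = ∑ T ∈ 𝒯, 2 ^ (3 * δ) *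
            (Finset.univ.filter fun E : ι → Fin m => ∀ t ∈ T, E t ∈ H T E).card :=
          Finset.mul_sum _ _ _
      _ ≤ ∑ _T ∈ 𝒯, N := by
          refine Finset.sum_le_sum fun T hT => ?_
          simp only [𝒯, Finset.mem_filter, Finset.mem_powerset] at hT
          refine le_trans (Nat.mul_le_mul_right _ ?_)
            (pow_card_mul_card_forall_mem_le (K := 2 ^ (3 * n)) T (H T) (hH T hT.1) (hK T))
          rw [← pow_mul]
          refine Nat.pow_le_pow_right two_pos ?_
          rw [mul_assoc]
          exact Nat.mul_le_mul_left _ hT.2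
      _ = 𝒯.card * N := by simp
      _ ≤ 2 ^ δ * N := Nat.mul_le_mul_right _ h𝒯
  have h2 : 2 ^ (3 * δ) = 2 ^ δ * 4 ^ δ := by
    rw [show 4 = 2 ^ 2 by norm_num, ← pow_mul, ← pow_add]; congr 1; ring
  rw [h2, mul_assoc] at h1
  exact Nat.le_of_mul_le_mul_left h1 (by positivity)

/-! ### The null space property from few collisions -/

/-- A null space property: if each column of the nonnegative matrix `W` has mass at least `4 * τ`,
of which at most `τ` is in rows met by other columns with index in `Ω`, then every vector in the
kernel of `W` has at least twice as much mass off `Ω` as on `Ω`. -/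
theorem two_mul_sum_abs_le_of_collision_le {Y X : Type*} [Fintype Y] [Fintype X] [DecidableEq X]
    (W : Y → X → ℝ) (hW : ∀ y x, 0 ≤ W y x) (Ω : Finset X) (C : X → Finset Y)
    (hC : ∀ x y, y ∈ C x ↔ ∃ x' ∈ Ω, x' ≠ x ∧ W y x' ≠ 0)
    {τ : ℝ} (hτ : 0 < τ) (hb : ∀ x, ∑ y ∈ C x, W y x ≤ τ) (ht : ∀ x, 4 * τ ≤ ∑ y, W y x)
    (v : X → ℝ) (hv : ∀ y, ∑ x, W y x * v x = 0) :
    2 * ∑ x ∈ Ω, |v x| ≤ ∑ x ∈ Ωᶜ, |v x| := by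
  classical
  -- If two columns of `Ω` meet row `y`, all its entries are collisions and the left side is
  -- nonpositive. If exactly one does, the kernel equation bounds its term by those off `Ω`, and
  -- these all count as collisions. Summed over `y`, the left coefficients are at least `4τ - 2τ`
  -- and the right ones at most `τ`.
  have row : ∀ y, ∑ x ∈ Ω, W y x * |v x| * (1 - 2 * if y ∈ C x then 1 else 0) ≤
      ∑ x ∈ Ωᶜ, W y x * |v x| * if y ∈ C x then 1 else 0 := by
    intro y
    have hnn : ∀ x, 0 ≤ W y x * |v x| := fun x => mul_nonneg (hW y x) (abs_nonneg _)
    have hR : 0 ≤ ∑ x ∈ Ωᶜ, W y x * |v x| * if y ∈ C x then (1 : ℝ) else 0 :=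
      Finset.sum_nonneg fun x _ => mul_nonneg (hnn x) (by split_ifs <;> norm_num)
    by_cases h0 : ∃ x₀ ∈ Ω, W y x₀ ≠ 0
    · obtain ⟨x₀, hx₀, hne⟩ := h0
      by_cases h1 : ∃ x₁ ∈ Ω, x₁ ≠ x₀ ∧ W y x₁ ≠ 0
      · obtain ⟨x₁, hx₁, h10, hne1⟩ := h1
        refine le_trans (Finset.sum_nonpos fun x _ => ?_) hR
        have : y ∈ C x := by
          rw [hC]
          by_cases hx : x₀ = x
          · exact ⟨x₁, hx₁, hx ▸ h10, hne1⟩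
          · exact ⟨x₀, hx₀, hx, hne⟩
        rw [if_pos this]
        have := hnn x
        linarith
      · push Not at h1
        have hE : ∑ x ∈ Ω, W y x * v x = W y x₀ * v x₀ :=
          Finset.sum_eq_single_of_mem x₀ hx₀ fun x hx hx' => by rw [h1 x hx hx', zero_mul]
        have hL : ∑ x ∈ Ω, W y x * |v x| * (1 - 2 * if y ∈ C x then (1 : ℝ) else 0) =
            W y x₀ * |v x₀| := by
          rw [Finset.sum_eq_single_of_mem x₀ hx₀
            fun x hx hx' => by rw [h1 x hx hx', zero_mul, zero_mul], if_neg]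
          · ring
          · rw [hC]
            rintro ⟨x', hx', hx'', h⟩
            exact h (h1 x' hx' hx'')
        have hR' : ∑ x ∈ Ωᶜ, W y x * |v x| * (if y ∈ C x then (1 : ℝ) else 0) =
            ∑ x ∈ Ωᶜ, |W y x * v x| := by
          refine Finset.sum_congr rfl fun x hx => ?_
          rw [if_pos, mul_one, abs_mul, abs_of_nonneg (hW y x)]
          rw [hC]
          exact ⟨x₀, hx₀, fun h => by simp [← h, hx₀] at hx, hne⟩
        have hsum : W y x₀ * v x₀ = -∑ x ∈ Ωᶜ, W y x * v x := by
          have := hv y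
          rw [← Finset.sum_add_sum_compl Ω, hE] at this
          linarith
        rw [hL, hR', ← abs_of_nonneg (hW y x₀), ← abs_mul, hsum, abs_neg]
        exact Finset.abs_sum_le_sum_abs _ _
    · push Not at h0
      rw [Finset.sum_eq_zero fun x hx => by rw [h0 x hx, zero_mul, zero_mul]]
      exact hR
  have tot := Finset.sum_le_sum fun y (_ : y ∈ Finset.univ) => row y
  rw [Finset.sum_comm, Finset.sum_comm (s := Finset.univ) (t := Ωᶜ)] at tot
  have hind : ∀ x, ∑ y, W y x * (if y ∈ C x then (1 : ℝ) else 0) = ∑ y ∈ C x, W y x := by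
    intro x
    simp [Finset.sum_ite_mem]
  have hl : ∀ x, 2 * τ * |v x| ≤
      ∑ y, W y x * |v x| * (1 - 2 * if y ∈ C x then (1 : ℝ) else 0) := by
    intro x
    have : ∑ y, W y x * |v x| * (1 - 2 * if y ∈ C x then (1 : ℝ) else 0) =
        |v x| * (∑ y, W y x - 2 * ∑ y ∈ C x, W y x) := by
      rw [← hind, Finset.mul_sum, ← Finset.sum_sub_distrib, Finset.mul_sum]
      exact Finset.sum_congr rfl fun y _ => by ring
    rw [this, mul_comm]
    exact mul_le_mul_of_nonneg_left (by linarith [hb x, ht x]) (abs_nonneg _)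
  have hr : ∀ x, ∑ y, W y x * |v x| * (if y ∈ C x then (1 : ℝ) else 0) ≤ τ * |v x| := by
    intro x
    have : ∑ y, W y x * |v x| * (if y ∈ C x then (1 : ℝ) else 0) =
        (∑ y ∈ C x, W y x) * |v x| := by
      rw [← hind, Finset.sum_mul]
      exact Finset.sum_congr rfl fun y _ => by ring
    rw [this]
    exact mul_le_mul_of_nonneg_right (hb x) (abs_nonneg _)
  have hfin := (Finset.sum_le_sum fun x (_ : x ∈ Ω) => hl x).trans
    (tot.trans (Finset.sum_le_sum fun x (_ : x ∈ Ωᶜ) => hr x))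
  rw [← Finset.mul_sum, ← Finset.mul_sum] at hfin
  nlinarith [hfin]

/-! ### Existence and error of `ℓ₁` minimizers -/

theorem entryNorm_eq_sum {p : ℕ} (X : Matrix (Fin p) (Fin p) ℝ) :
    entryNorm X = ∑ x : Fin p × Fin p, |X x.1 x.2| := by
  rw [entryNorm, Fintype.sum_prod_type]

theorem abs_apply_le_entryNorm {p : ℕ} (X : Matrix (Fin p) (Fin p) ℝ) (i j : Fin p) :
    |X i j| ≤ entryNorm X := by
  rw [entryNorm_eq_sum]
  exact Finset.single_le_sum (f := fun x : Fin p × Fin p => |X x.1 x.2|)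
    (fun _ _ => abs_nonneg _) (Finset.mem_univ (i, j))

theorem continuous_entryNorm {p : ℕ} :
    Continuous (entryNorm : Matrix (Fin p) (Fin p) ℝ → ℝ) := by
  unfold entryNorm
  fun_prop

/-- The feasible matrices of norm at most `‖X‖₁` form a nonempty compact set; feasible matrices
outside it are worse than `X`. -/
theorem exists_isL1Solution {m p : ℕ} (A B : Matrix (Fin m) (Fin p) ℝ)
    (X : Matrix (Fin p) (Fin p) ℝ) : ∃ Z, IsL1Solution A B (A * X * Bᵀ) Z := by
  let s : Set (Matrix (Fin p) (Fin p) ℝ) :=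
    {Z | A * Z * Bᵀ = A * X * Bᵀ ∧ entryNorm Z ≤ entryNorm X}
  have hbox : IsCompact (Set.univ.pi fun _ : Fin p => Set.univ.pi fun _ : Fin p =>
      Set.Icc (-entryNorm X) (entryNorm X)) :=
    isCompact_univ_pi fun _ => isCompact_univ_pi fun _ => isCompact_Icc
  have hcl : IsClosed s := by
    refine IsClosed.inter (isClosed_eq ?_ continuous_const)
      (isClosed_le continuous_entryNorm continuous_const)
    exact (continuous_const.matrix_mul continuous_id).matrix_mul continuous_const
  have hs : IsCompact s := by
    refine hbox.of_isClosed_subset hcl fun Z hZ => ?_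
    simp only [Set.mem_pi, Set.mem_univ, true_imp_iff, Set.mem_Icc]
    intro i j
    exact abs_le.1 ((abs_apply_le_entryNorm Z i j).trans hZ.2)
  obtain ⟨Z, hZ, hmin⟩ := hs.exists_isMinOn ⟨X, rfl, le_rfl⟩ continuous_entryNorm.continuousOn
  refine ⟨Z, hZ.1, fun X' hX' => ?_⟩
  by_cases h : entryNorm X' ≤ entryNorm X
  · exact hmin ⟨hX', h⟩
  · exact hZ.2.trans (le_of_not_ge h)

theorem entryNorm_sub_restrictTo {p : ℕ} (Ω : Finset (Fin p × Fin p))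
    (X : Matrix (Fin p) (Fin p) ℝ) :
    entryNorm (X - restrictTo Ω X) = ∑ x ∈ Ωᶜ, |X x.1 x.2| := by
  rw [entryNorm_eq_sum, ← Finset.sum_add_sum_compl Ω, Finset.sum_eq_zero, zero_add]
  · exact Finset.sum_congr rfl fun x hx => by simp [restrictTo, Finset.mem_compl.1 hx]
  · intro x hx
    simp [restrictTo, hx]

/-- The null space property for `Ω` bounds the error of `ℓ₁` minimization by six times the mass
of `X` off `Ω`. -/
theorem IsL1Solution.entryNorm_sub_le {m p : ℕ} {A B : Matrix (Fin m) (Fin p) ℝ}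
    {X Z : Matrix (Fin p) (Fin p) ℝ} {Ω : Finset (Fin p × Fin p)}
    (hker : ∀ V : Matrix (Fin p) (Fin p) ℝ, A * V * Bᵀ = 0 →
      2 * ∑ x ∈ Ω, |V x.1 x.2| ≤ ∑ x ∈ Ωᶜ, |V x.1 x.2|)
    (hZ : IsL1Solution A B (A * X * Bᵀ) Z) :
    entryNorm (Z - X) ≤ 6 * ∑ x ∈ Ωᶜ, |X x.1 x.2| := by
  have h1 := hker (Z - X) (by rw [Matrix.mul_sub, Matrix.sub_mul, hZ.1, sub_self])
  have h2 := hZ.2 X rfl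
  rw [entryNorm_eq_sum, entryNorm_eq_sum X, ← Finset.sum_add_sum_compl Ω,
    ← Finset.sum_add_sum_compl Ω fun x => |X x.1 x.2|] at h2
  rw [entryNorm_eq_sum, ← Finset.sum_add_sum_compl Ω]
  have h3 : ∑ x ∈ Ω, |X x.1 x.2| ≤ ∑ x ∈ Ω, |Z x.1 x.2| + ∑ x ∈ Ω, |(Z - X) x.1 x.2| := by
    rw [← Finset.sum_add_distrib]
    refine Finset.sum_le_sum fun x _ => ?_
    rw [Matrix.sub_apply, abs_sub_comm]
    linarith [abs_sub_abs_le_abs_sub (X x.1 x.2) (Z x.1 x.2)]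
  have h4 : ∑ x ∈ Ωᶜ, |(Z - X) x.1 x.2| ≤ ∑ x ∈ Ωᶜ, |Z x.1 x.2| + ∑ x ∈ Ωᶜ, |X x.1 x.2| := by
    rw [← Finset.sum_add_distrib]
    exact Finset.sum_le_sum fun x _ => abs_sub _ _
  -- With `s`, `t` the masses of `Z - X` on and off `Ω` and `σ` that of `X` off `Ω`, optimality
  -- gives `t ≤ s + 2σ`. Together with `2s ≤ t` this yields `s ≤ 2σ` and `t ≤ 4σ`.
  linarith

theorem approximatelyRecovers_of_kernel {m p d : ℕ} {A B : Matrix (Fin m) (Fin p) ℝ}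
    {X : Matrix (Fin p) (Fin p) ℝ} {Ω : Finset (Fin p × Fin p)}
    (hΩ : bestDistributedError d X = entryNorm (X - restrictTo Ω X))
    (hker : ∀ V : Matrix (Fin p) (Fin p) ℝ, A * V * Bᵀ = 0 →
      2 * ∑ x ∈ Ω, |V x.1 x.2| ≤ ∑ x ∈ Ωᶜ, |V x.1 x.2|) :
    ApproximatelyRecovers (1 / 5) d A B X := by
  refine ⟨exists_isL1Solution A B X, fun Z hZ => ?_⟩
  rw [hΩ, entryNorm_sub_restrictTo]
  have := hZ.entryNorm_sub_le hker
  norm_num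
  exact this

/-! ### Collisions of edges in a random left regular graph -/

/-- The right endpoints of the edges at the left vertex `w`. -/
def neighbors {V : Type*} {δ m : ℕ} (E : V × Fin δ → Fin m) (w : V) : Finset (Fin m) :=
  Finset.univ.image fun k => E (w, k)

/-- The edges at `w` that end in the neighborhood of `L`. -/
def edgesInto {V : Type*} {δ m : ℕ} (E : V × Fin δ → Fin m) (w : V) (L : Finset V) :
    Finset (Fin δ) :=
  Finset.univ.filter fun k => ∃ l ∈ L, E (w, k) ∈ neighbors E l

/-- The second coordinates of the right vertices `(j, _)` of the product graph that are adjacent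
to `R`. -/
def fiber {V : Type*} {δ m : ℕ} (E : V × Fin δ → Fin m) (R : Finset (V × V)) (j : Fin m) :
    Finset (Fin m) :=
  Finset.univ.filter fun j' => ∃ x ∈ R, j ∈ neighbors E x.1 ∧ j' ∈ neighbors E x.2

/-- The right vertices whose fibers have density more than `1 / K`. -/
def heavy {V : Type*} {δ m : ℕ} (K : ℕ) (E : V × Fin δ → Fin m) (R : Finset (V × V)) :
    Finset (Fin m) :=
  Finset.univ.filter fun j => m < K * (fiber E R j).card

/-- The edges at `b`, other than the `k`-th edge at `a`, which end in the fiber over the endpoint of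
the `k`-th edge at `a`. -/
def edgesIntoFiber {V : Type*} [DecidableEq V] {δ m : ℕ} (E : V × Fin δ → Fin m)
    (R : Finset (V × V)) (a b : V) (k : Fin δ) : Finset (Fin δ) :=
  Finset.univ.filter fun k' => (b, k') ≠ (a, k) ∧ E (b, k') ∈ fiber E R (E (a, k))

section

variable {V : Type*} {δ m : ℕ}

theorem mem_neighbors {E : V × Fin δ → Fin m} {w : V} {j : Fin m} :
    j ∈ neighbors E w ↔ ∃ k, E (w, k) = j := by
  simp [neighbors]

theorem card_neighbors_le (E : V × Fin δ → Fin m) (w : V) : (neighbors E w).card ≤ δ :=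
  Finset.card_image_le.trans (by simp)

theorem neighbors_congr {E E' : V × Fin δ → Fin m} {w : V} (h : ∀ k, E (w, k) = E' (w, k)) :
    neighbors E w = neighbors E' w := by
  simp [neighbors, h]

theorem mem_fiber {E : V × Fin δ → Fin m} {R : Finset (V × V)} {j j' : Fin m} :
    j' ∈ fiber E R j ↔ ∃ x ∈ R, j ∈ neighbors E x.1 ∧ j' ∈ neighbors E x.2 := by
  simp [fiber]

theorem fiber_congr {E E' : V × Fin δ → Fin m} {R : Finset (V × V)}
    (h : ∀ x ∈ R, neighbors E x.1 = neighbors E' x.1 ∧ neighbors E x.2 = neighbors E' x.2)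
    (j : Fin m) : fiber E R j = fiber E' R j := by
  ext j'
  rw [mem_fiber, mem_fiber]
  refine exists_congr fun x => and_congr_right fun hx => ?_
  rw [(h x hx).1, (h x hx).2]

/-- Markov's inequality: the fibers have total size at most `|R| δ² ≤ m² / K²`, and each heavy one
has size more than `m / K`. -/
theorem mul_card_heavy_le {K : ℕ} (E : V × Fin δ → Fin m) (R : Finset (V × V))
    (hR : K ^ 2 * (R.card * δ ^ 2) ≤ m ^ 2) : K * (heavy K E R).card ≤ m := by
  classical
  rcases Nat.eq_zero_or_pos m with rfl | hm
  · simp [Finset.eq_empty_of_isEmpty]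
  have h1 : ((heavy K E R).sigma fun j => fiber E R j).card ≤ R.card * δ ^ 2 := by
    calc ((heavy K E R).sigma fun j => fiber E R j).card
        ≤ (R.biUnion fun x => neighbors E x.1 ×ˢ neighbors E x.2).card := by
          refine Finset.card_le_card_of_injOn (fun y => (y.1, y.2)) ?_ ?_
          · rintro ⟨j, j'⟩ h
            simp only [Finset.mem_coe, Finset.mem_sigma, mem_fiber] at h
            simp only [Finset.coe_biUnion, Set.mem_iUnion, Finset.mem_coe, Finset.mem_product]
            obtain ⟨x, hx, h⟩ := h.2
            exact ⟨x, hx, h⟩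
          · rintro ⟨j, j'⟩ - ⟨l, l'⟩ - h
            simp only [Prod.mk.injEq] at h
            rw [h.1, h.2]
      _ ≤ ∑ x ∈ R, (neighbors E x.1 ×ˢ neighbors E x.2).card := Finset.card_biUnion_le
      _ ≤ ∑ _x ∈ R, δ ^ 2 := Finset.sum_le_sum fun x _ => by
          rw [Finset.card_product, sq]
          exact Nat.mul_le_mul (card_neighbors_le _ _) (card_neighbors_le _ _)
      _ = R.card * δ ^ 2 := by simp
  have h2 : (heavy K E R).card * m ≤ K * (R.card * δ ^ 2) := by
    calc (heavy K E R).card * m = ∑ _j ∈ heavy K E R, m := by simp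
      _ ≤ ∑ j ∈ heavy K E R, K * (fiber E R j).card := Finset.sum_le_sum fun j hj => by
          simp only [heavy, Finset.mem_filter] at hj
          exact hj.2.le
      _ = K * ((heavy K E R).sigma fun j => fiber E R j).card := by
          rw [Finset.card_sigma, Finset.mul_sum]
      _ ≤ _ := Nat.mul_le_mul_left _ h1
  refine Nat.le_of_mul_le_mul_right (c := m) ?_ hm
  calc K * (heavy K E R).card * m = K * ((heavy K E R).card * m) := by ring
    _ ≤ K * (K * (R.card * δ ^ 2)) := Nat.mul_le_mul_left _ h2
    _ = K ^ 2 * (R.card * δ ^ 2) := by ring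
    _ ≤ m * m := by rw [← sq]; exact hR

variable [Fintype V] [DecidableEq V] {n : ℕ}

/-- The neighborhood of `L` has at most `|L| δ` elements and, as `w ∉ L`, is independent of the
edges at `w`. -/
theorem four_pow_mul_card_edgesInto_le {w : V} {L : Finset V} (hw : w ∉ L)
    (hL : 2 ^ (3 * n) * (L.card * δ) ≤ m) :
    4 ^ δ * (Finset.univ.filter fun E : V × Fin δ → Fin m =>
      δ ≤ n * (edgesInto E w L).card).card ≤ Fintype.card (V × Fin δ → Fin m) := by
  refine four_pow_mul_card_filter_le (n := n) ({w} ×ˢ Finset.univ) (by simp)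
    (fun _ E => L.biUnion (neighbors E)) ?_ ?_ _ ?_
  · intro T hT E E' h
    refine Finset.biUnion_congr rfl fun l hl => neighbors_congr fun k => h _ fun hk => hw ?_
    have := hT hk
    simp only [Finset.mem_product, Finset.mem_singleton] at this
    rwa [← this.1]
  · intro _ E
    refine le_trans (Nat.mul_le_mul_left _ ?_) hL
    exact Finset.card_biUnion_le_card_mul _ _ _ fun l _ => card_neighbors_le E l
  · intro E hE
    refine ⟨{w} ×ˢ edgesInto E w L, Finset.product_subset_product_right (Finset.subset_univ _),
      by simpa using hE, ?_⟩
    rintro ⟨w', k⟩ hk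
    simp only [Finset.mem_product, Finset.mem_singleton] at hk
    obtain ⟨rfl, hk⟩ := hk
    simpa [edgesInto] using hk

/-- The heavy set is sparse by `mul_card_heavy_le`, and it is independent of the edges at `a`
because `R` avoids `a`. -/
theorem four_pow_mul_card_edges_into_heavy_le {a : V} {R : Finset (V × V)}
    (ha : ∀ x ∈ R, x.1 ≠ a ∧ x.2 ≠ a) (hR : (2 ^ (3 * n)) ^ 2 * (R.card * δ ^ 2) ≤ m ^ 2) :
    4 ^ δ * (Finset.univ.filter fun E : V × Fin δ → Fin m =>
      δ ≤ n * (Finset.univ.filter fun k => E (a, k) ∈ heavy (2 ^ (3 * n)) E R).card).card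
      ≤ Fintype.card (V × Fin δ → Fin m) := by
  refine four_pow_mul_card_filter_le (n := n) ({a} ×ˢ Finset.univ) (by simp)
    (fun _ E => heavy (2 ^ (3 * n)) E R) ?_ (fun _ E => mul_card_heavy_le E R hR) _ ?_
  · intro T hT E E' h
    have hn : ∀ w, w ≠ a → neighbors E w = neighbors E' w := fun w hw =>
      neighbors_congr fun k => h _ fun hk => hw (by simpa [eq_comm] using hT hk)
    simp only [heavy, fiber_congr fun x hx => ⟨hn _ (ha x hx).1, hn _ (ha x hx).2⟩]
  · intro E hE
    refine ⟨{a} ×ˢ Finset.univ.filter fun k => E (a, k) ∈ heavy (2 ^ (3 * n)) E R,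
      Finset.product_subset_product_right (Finset.subset_univ _), by simpa using hE, ?_⟩
    rintro ⟨w', k⟩ hk
    simp only [Finset.mem_product, Finset.mem_singleton] at hk
    obtain ⟨rfl, hk⟩ := hk
    simpa using hk

theorem four_pow_mul_card_edgesIntoFiber_le {a b : V} {R : Finset (V × V)}
    (hb : ∀ x ∈ R, x.1 ≠ b ∧ x.2 ≠ b) (k : Fin δ) :
    4 ^ δ * (Finset.univ.filter fun E : V × Fin δ → Fin m =>
      E (a, k) ∉ heavy (2 ^ (3 * n)) E R ∧ δ ≤ n * (edgesIntoFiber E R a b k).card).card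
      ≤ Fintype.card (V × Fin δ → Fin m) := by
  classical
  -- The edge `(a, k)` selects the fiber, so it must stay fixed; removing it matters when `a = b`.
  -- Replacing the fiber by `∅` in the heavy case makes the density bound hold for every `E`.
  refine four_pow_mul_card_filter_le (n := n) (({b} ×ˢ Finset.univ).erase (a, k))
    ((Finset.card_erase_le).trans (by simp))
    (fun _ E => if E (a, k) ∈ heavy (2 ^ (3 * n)) E R then ∅ else fiber E R (E (a, k))) ?_ ?_ _ ?_
  · intro T hT E E' h
    have hn : ∀ w, w ≠ b → neighbors E w = neighbors E' w := fun w hw =>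
      neighbors_congr fun k => h _ fun hk =>
        hw (by simpa [eq_comm] using Finset.mem_of_mem_erase (hT hk))
    have hk : E (a, k) = E' (a, k) := h _ fun hk => by simpa using hT hk
    have hf : ∀ j, fiber E R j = fiber E' R j :=
      fiber_congr fun x hx => ⟨hn _ (hb x hx).1, hn _ (hb x hx).2⟩
    have hv : heavy (2 ^ (3 * n)) E R = heavy (2 ^ (3 * n)) E' R := by simp only [heavy, hf]
    simp only [hv, hf, hk]
  · intro _ E
    split_ifs with h
    · simp
    · simpa [heavy] using h
  · rintro E ⟨hE, hc⟩
    refine ⟨{b} ×ˢ edgesIntoFiber E R a b k, ?_, by simpa using hc, ?_⟩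
    · rintro ⟨w, k'⟩ hk
      simp only [Finset.mem_product, Finset.mem_singleton, edgesIntoFiber, Finset.mem_filter] at hk
      obtain ⟨rfl, -, hk, -⟩ := hk
      simp [hk]
    · rintro ⟨w, k'⟩ hk
      simp only [Finset.mem_product, Finset.mem_singleton, edgesIntoFiber, Finset.mem_filter] at hk
      obtain ⟨rfl, -, -, hk⟩ := hk
      rwa [if_neg hE]

/-- Choose one edge for each neighbor of `w`. The remaining edges `T` all end in the image of the
chosen ones, which has at most `δ` elements and does not depend on `T`. -/
theorem four_pow_mul_card_neighbors_le {w : V} (hm : 2 ^ (3 * n) * δ ≤ m) :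
    4 ^ δ * (Finset.univ.filter fun E : V × Fin δ → Fin m =>
      δ ≤ n * (δ - (neighbors E w).card)).card ≤ Fintype.card (V × Fin δ → Fin m) := by
  classical
  refine four_pow_mul_card_filter_le (n := n) ({w} ×ˢ Finset.univ) (by simp)
    (fun T E => (Finset.univ.filter fun k => (w, k) ∉ T).image fun k => E (w, k)) ?_ ?_ _ ?_
  · intro T hT E E' h
    refine Finset.image_congr fun k hk => h _ ?_
    simpa using hk
  · intro T E
    refine le_trans (Nat.mul_le_mul_left _ ?_) hm
    exact Finset.card_image_le.trans ((Finset.card_filter_le _ _).trans (by simp))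
  · intro E hE
    obtain ⟨s, -, hs, himg⟩ := Finset.exists_subset_injOn_image_eq_of_surjOn
      (f := fun k => E (w, k)) (Set.univ : Set (Fin δ)) (neighbors E w) (by
        intro j hj
        simpa [neighbors] using hj)
    have hcard : (neighbors E w).card = s.card := by
      rw [← himg, Finset.card_image_of_injOn hs]
    refine ⟨{w} ×ˢ sᶜ, Finset.product_subset_product_right (Finset.subset_univ _), ?_, ?_⟩
    · simpa [Finset.card_compl, ← hcard] using hE
    · rintro ⟨w', k⟩ hk
      simp only [Finset.mem_product, Finset.mem_singleton] at hk
      obtain ⟨rfl, hk⟩ := hk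
      have : E (w', k) ∈ neighbors E w' := mem_neighbors.2 ⟨k, rfl⟩
      rw [← himg] at this
      simpa using this

end

/-! ### All collisions at one vertex of the product graph -/

/-- Few edges of the product graph at `(a, b)` end in places that are also reached from elsewhere:
few edges at `a` end in the neighborhood of `La`, few edges at `b` end in the neighborhood of `Lb`,
few pairs of edges end in the neighborhood of `R`, and few edges at `a` or at `b` are repeated. -/
structure FewCollisions {V : Type*} [DecidableEq V] {δ m : ℕ} (n : ℕ) (a b : V)
    (La Lb : Finset V) (R : Finset (V × V)) (E : V × Fin δ → Fin m) : Prop where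
  left : n * (edgesInto E a La).card < δ
  right : n * (edgesInto E b Lb).card < δ
  into_heavy : n * (Finset.univ.filter fun k => E (a, k) ∈ heavy (2 ^ (3 * n)) E R).card < δ
  into_fiber : ∀ k, E (a, k) ∉ heavy (2 ^ (3 * n)) E R → n * (edgesIntoFiber E R a b k).card < δ
  left_repeated : n * (δ - (neighbors E a).card) < δ
  right_repeated : n * (δ - (neighbors E b).card) < δ

/-- Five of the conditions are single events and `into_fiber` is one event for each of the `δ` edges
at `a`, hence the factor `δ + 5`. -/
theorem four_pow_mul_card_not_fewCollisions_le {V : Type*} [Fintype V] [DecidableEq V] {δ m n : ℕ}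
    {a b : V} {La Lb : Finset V} {R : Finset (V × V)} (ha : a ∉ La) (hb : b ∉ Lb)
    (hRa : ∀ x ∈ R, x.1 ≠ a ∧ x.2 ≠ a) (hRb : ∀ x ∈ R, x.1 ≠ b ∧ x.2 ≠ b)
    (hLa : 2 ^ (3 * n) * (La.card * δ) ≤ m) (hLb : 2 ^ (3 * n) * (Lb.card * δ) ≤ m)
    (hR : (2 ^ (3 * n)) ^ 2 * (R.card * δ ^ 2) ≤ m ^ 2) (hm : 2 ^ (3 * n) * δ ≤ m)
    [DecidablePred fun E : V × Fin δ → Fin m => ¬ FewCollisions n a b La Lb R E] :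
    4 ^ δ * (Finset.univ.filter fun E : V × Fin δ → Fin m =>
      ¬ FewCollisions n a b La Lb R E).card ≤ (δ + 5) * Fintype.card (V × Fin δ → Fin m) := by
  classical
  set N := Fintype.card (V × Fin δ → Fin m)
  have h1 := four_pow_mul_card_edgesInto_le (δ := δ) ha hLa
  have h2 := four_pow_mul_card_edgesInto_le (δ := δ) hb hLb
  have h3 := four_pow_mul_card_edges_into_heavy_le (δ := δ) hRa hR
  have h4 := four_pow_mul_card_edgesIntoFiber_le (n := n) (m := m) (δ := δ) (a := a) hRb
  have h5 := four_pow_mul_card_neighbors_le (n := n) (δ := δ) (w := a) hm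
  have h6 := four_pow_mul_card_neighbors_le (n := n) (δ := δ) (w := b) hm
  set F1 := Finset.univ.filter fun E : V × Fin δ → Fin m => δ ≤ n * (edgesInto E a La).card
  set F2 := Finset.univ.filter fun E : V × Fin δ → Fin m => δ ≤ n * (edgesInto E b Lb).card
  set F3 := Finset.univ.filter fun E : V × Fin δ → Fin m =>
      δ ≤ n * (Finset.univ.filter fun k => E (a, k) ∈ heavy (2 ^ (3 * n)) E R).card
  let F4 := fun k => Finset.univ.filter fun E : V × Fin δ → Fin m =>
      E (a, k) ∉ heavy (2 ^ (3 * n)) E R ∧ δ ≤ n * (edgesIntoFiber E R a b k).card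
  set F5 := Finset.univ.filter fun E : V × Fin δ → Fin m => δ ≤ n * (δ - (neighbors E a).card)
  set F6 := Finset.univ.filter fun E : V × Fin δ → Fin m => δ ≤ n * (δ - (neighbors E b).card)
  have hsub : (Finset.univ.filter fun E : V × Fin δ → Fin m =>
      ¬ FewCollisions n a b La Lb R E) ⊆
        F1 ∪ (F2 ∪ (F3 ∪ (Finset.univ.biUnion F4 ∪ (F5 ∪ F6)))) := by
    intro E hE
    by_contra hn
    simp only [Finset.mem_union, Finset.mem_biUnion, Finset.mem_filter, Finset.mem_univ, true_and,
      not_or, not_exists, not_and, not_le, F1, F2, F3, F4, F5, F6] at hn hE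
    obtain ⟨g1, g2, g3, g4, g5, g6⟩ := hn
    exact hE ⟨g1, g2, g3, g4, g5, g6⟩
  have h4' : 4 ^ δ * (Finset.univ.biUnion F4).card ≤ δ * N := by
    calc 4 ^ δ * (Finset.univ.biUnion F4).card ≤ 4 ^ δ * ∑ k, (F4 k).card :=
          Nat.mul_le_mul_left _ Finset.card_biUnion_le
      _ = ∑ k, 4 ^ δ * (F4 k).card := Finset.mul_sum _ _ _
      _ ≤ ∑ _k : Fin δ, N := Finset.sum_le_sum fun k _ => h4 k
      _ = δ * N := by simp
  have hcard := Finset.card_le_card hsub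
  have u1 := Finset.card_union_le F1 (F2 ∪ (F3 ∪ (Finset.univ.biUnion F4 ∪ (F5 ∪ F6))))
  have u2 := Finset.card_union_le F2 (F3 ∪ (Finset.univ.biUnion F4 ∪ (F5 ∪ F6)))
  have u3 := Finset.card_union_le F3 (Finset.univ.biUnion F4 ∪ (F5 ∪ F6))
  have u4 := Finset.card_union_le (Finset.univ.biUnion F4) (F5 ∪ F6)
  have u5 := Finset.card_union_le F5 F6
  calc _ ≤ 4 ^ δ * (F1.card + (F2.card + (F3.card + ((Finset.univ.biUnion F4).card +
        (F5.card + F6.card))))) := Nat.mul_le_mul_left _ (by omega)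
    _ = 4 ^ δ * F1.card + (4 ^ δ * F2.card + (4 ^ δ * F3.card +
        (4 ^ δ * (Finset.univ.biUnion F4).card + (4 ^ δ * F5.card + 4 ^ δ * F6.card)))) := by ring
    _ ≤ N + (N + (N + (δ * N + (N + N)))) := by gcongr
    _ = (δ + 5) * N := by ring

theorem FewCollisions.mul_card_le {V : Type*} [DecidableEq V] {δ m n : ℕ}
    {a b : V} {La Lb : Finset V} {R : Finset (V × V)} {E : V × Fin δ → Fin m}
    (h : FewCollisions n a b La Lb R E) (C : Finset (Fin m × Fin m))
    (hC : ∀ k k', (E (a, k), E (b, k')) ∈ C →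
      k ∈ edgesInto E a La ∨ k' ∈ edgesInto E b Lb ∨ E (b, k') ∈ fiber E R (E (a, k))) :
    n * (Finset.univ.filter fun q : Fin δ × Fin δ => (E (a, q.1), E (b, q.2)) ∈ C).card
      ≤ 4 * δ ^ 2 + n * δ := by
  classical
  set Q := Finset.univ.filter fun k => E (a, k) ∈ heavy (2 ^ (3 * n)) E R
  -- When `a = b`, the pair `(k, k)` uses a single edge twice and is not controlled by
  -- `edgesIntoFiber`. Inserting `k` pays for these `δ` diagonal pairs and produces the term `n *
  -- δ`.
  have hsub : (Finset.univ.filter fun q : Fin δ × Fin δ => (E (a, q.1), E (b, q.2)) ∈ C) ⊆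
      edgesInto E a La ×ˢ Finset.univ ∪ (Finset.univ ×ˢ edgesInto E b Lb ∪ (Q ×ˢ Finset.univ ∪
        Qᶜ.biUnion fun k => {k} ×ˢ insert k (edgesIntoFiber E R a b k))) := by
    rintro ⟨k, k'⟩ hk
    simp only [Finset.mem_filter, Finset.mem_univ, true_and] at hk
    simp only [Finset.mem_union, Finset.mem_product, Finset.mem_univ, true_and, and_true,
      Finset.mem_biUnion, Finset.mem_singleton, Finset.mem_compl, Finset.mem_insert]
    rcases hC k k' hk with h | h | h
    · exact Or.inl h
    · exact Or.inr (Or.inl h)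
    · by_cases hq : k ∈ Q
      · exact Or.inr (Or.inr (Or.inl hq))
      · refine Or.inr (Or.inr (Or.inr ⟨k, hq, rfl, ?_⟩))
        by_cases hkk : k' = k
        · exact Or.inl hkk
        · exact Or.inr (by simp [edgesIntoFiber, hkk, h])
  have hlast : n * (Qᶜ.biUnion fun k => {k} ×ˢ insert k (edgesIntoFiber E R a b k)).card
      ≤ δ * (δ + n) := by
    calc n * (Qᶜ.biUnion fun k => {k} ×ˢ insert k (edgesIntoFiber E R a b k)).card
        ≤ n * ∑ k ∈ Qᶜ, ({k} ×ˢ insert k (edgesIntoFiber E R a b k)).card :=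
          Nat.mul_le_mul_left _ Finset.card_biUnion_le
      _ = ∑ k ∈ Qᶜ, n * ({k} ×ˢ insert k (edgesIntoFiber E R a b k)).card := Finset.mul_sum _ _ _
      _ ≤ ∑ _k ∈ Qᶜ, (δ + n) := by
          refine Finset.sum_le_sum fun k hk => ?_
          rw [Finset.card_product, Finset.card_singleton, one_mul]
          have h1 := h.into_fiber k (by simpa [Q] using hk)
          have h2 := Finset.card_insert_le k (edgesIntoFiber E R a b k)
          calc n * (insert k (edgesIntoFiber E R a b k)).card
              ≤ n * ((edgesIntoFiber E R a b k).card + 1) := Nat.mul_le_mul_left _ h2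
            _ = n * (edgesIntoFiber E R a b k).card + n := by ring
            _ ≤ δ + n := by omega
      _ = Qᶜ.card * (δ + n) := by simp
      _ ≤ δ * (δ + n) := Nat.mul_le_mul_right _ ((Finset.card_le_univ _).trans (by simp))
  have u0 := Finset.card_le_card hsub
  have u1 := Finset.card_union_le (edgesInto E a La ×ˢ Finset.univ) (Finset.univ ×ˢ edgesInto E b Lb
    ∪ (Q ×ˢ Finset.univ ∪ Qᶜ.biUnion fun k => {k} ×ˢ insert k (edgesIntoFiber E R a b k)))
  have u2 := Finset.card_union_le (Finset.univ ×ˢ edgesInto E b Lb)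
    (Q ×ˢ Finset.univ ∪ Qᶜ.biUnion fun k => {k} ×ˢ insert k (edgesIntoFiber E R a b k))
  have u3 := Finset.card_union_le (Q ×ˢ Finset.univ)
    (Qᶜ.biUnion fun k => {k} ×ˢ insert k (edgesIntoFiber E R a b k))
  simp only [Finset.card_product, Finset.card_univ, Fintype.card_fin] at u1 u2 u3
  have g1 := Nat.mul_le_mul_right δ h.left.le
  have g2 := Nat.mul_le_mul_right δ h.right.le
  have g3 := Nat.mul_le_mul_right δ h.into_heavy.le
  calc _ ≤ n * ((edgesInto E a La).card * δ + (δ * (edgesInto E b Lb).card + (Q.card * δ +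
        (Qᶜ.biUnion fun k => {k} ×ˢ insert k (edgesIntoFiber E R a b k)).card))) :=
        Nat.mul_le_mul_left _ (by omega)
    _ = n * (edgesInto E a La).card * δ + (n * (edgesInto E b Lb).card * δ + (n * Q.card * δ +
        n * (Qᶜ.biUnion fun k => {k} ×ˢ insert k (edgesIntoFiber E R a b k)).card)) := by ring
    _ ≤ δ * δ + (δ * δ + (δ * δ + δ * (δ + n))) := by gcongr
    _ = _ := by ring

/-! ### Adjacency matrices and the mass of columns -/

/-- The common properties of the two kinds of adjacency matrices. -/
structure IsAdjacency {p δ m : ℕ} (adj : EdgeChoice p δ m → Matrix (Fin m) (Fin p) ℝ) : Prop where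
  nonneg : ∀ F j i, 0 ≤ adj F j i
  ne_zero_iff : ∀ F j i, adj F j i ≠ 0 ↔ ∃ k, F i k = j
  le_card : ∀ F j i, adj F j i ≤ (Finset.univ.filter fun k => F i k = j).card
  card_image_le : ∀ F i, ((Finset.univ.image (F i)).card : ℝ) ≤ ∑ j, adj F j i

theorem isAdjacency_simpleAdj {p δ m : ℕ} : IsAdjacency (simpleAdj : EdgeChoice p δ m → _) where
  nonneg F j i := by simp only [simpleAdj, Matrix.of_apply]; split_ifs <;> norm_num
  ne_zero_iff F j i := by simp [simpleAdj]
  le_card F j i := by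
    simp only [simpleAdj, Matrix.of_apply]
    split_ifs with h
    · obtain ⟨k, hk⟩ := h
      exact_mod_cast Finset.card_pos.2 ⟨k, by simp [hk]⟩
    · positivity
  card_image_le F i := by
    simp only [simpleAdj, Matrix.of_apply, Finset.sum_boole]
    refine Nat.cast_le.2 (Finset.card_le_card fun j hj => ?_)
    simpa using hj

theorem isAdjacency_multiAdj {p δ m : ℕ} : IsAdjacency (multiAdj : EdgeChoice p δ m → _) where
  nonneg F j i := by simp only [multiAdj, Matrix.of_apply]; positivity
  ne_zero_iff F j i := by
    simp [multiAdj, Finset.filter_eq_empty_iff]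
  le_card F j i := by simp [multiAdj]
  card_image_le F i := by
    simp only [multiAdj, Matrix.of_apply]
    rw [← Nat.cast_sum, ← Finset.card_eq_sum_card_fiberwise (fun _ _ => Finset.mem_coe.2
      (Finset.mem_univ _))]
    exact Nat.cast_le.2 Finset.card_image_le

theorem Matrix.mul_mul_transpose_apply_eq_sum {m p : ℕ} (A B : Matrix (Fin m) (Fin p) ℝ)
    (V : Matrix (Fin p) (Fin p) ℝ) (y : Fin m × Fin m) :
    (A * V * Bᵀ) y.1 y.2 = ∑ x : Fin p × Fin p, A y.1 x.1 * B y.2 x.2 * V x.1 x.2 := by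
  rw [Fintype.sum_prod_type, Finset.sum_comm, Matrix.mul_apply]
  refine Finset.sum_congr rfl fun i' _ => ?_
  rw [Matrix.mul_apply, Finset.sum_mul]
  refine Finset.sum_congr rfl fun i _ => ?_
  rw [Matrix.transpose_apply]
  ring

/-- Entries are at most edge multiplicities, and products of multiplicities count the pairs of edges
with given endpoints. -/
theorem IsAdjacency.sum_mul_le_card {p δ m : ℕ} {adj : EdgeChoice p δ m → Matrix (Fin m) (Fin p) ℝ}
    (hadj : IsAdjacency adj) (F G : EdgeChoice p δ m) (i i' : Fin p) (C : Finset (Fin m × Fin m)) :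
    ∑ y ∈ C, adj F y.1 i * adj G y.2 i' ≤
      ((Finset.univ.filter fun q : Fin δ × Fin δ => (F i q.1, G i' q.2) ∈ C).card : ℝ) := by
  classical
  rw [Finset.card_eq_sum_card_fiberwise (f := fun q : Fin δ × Fin δ => (F i q.1, G i' q.2)) (t := C)
    (fun q hq => by simpa using hq), Nat.cast_sum]
  refine Finset.sum_le_sum fun y hy => ?_
  have : ((Finset.univ.filter fun q : Fin δ × Fin δ => (F i q.1, G i' q.2) ∈ C).filter
      fun q => (F i q.1, G i' q.2) = y) =
      (Finset.univ.filter fun k => F i k = y.1) ×ˢ (Finset.univ.filter fun k => G i' k = y.2) := by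
    ext q
    simp only [Finset.mem_filter, Finset.mem_univ, true_and, Finset.mem_product, Prod.ext_iff]
    constructor
    · exact fun h => h.2
    · rintro ⟨h1, h2⟩
      exact ⟨by rw [h1, h2]; exact hy, h1, h2⟩
  rw [this, Finset.card_product, Nat.cast_mul]
  exact mul_le_mul (hadj.le_card _ _ _) (hadj.le_card _ _ _) (hadj.nonneg _ _ _) (by positivity)

/-! ### The null space property for the product matrix -/

section

variable {V : Type*} [DecidableEq V] {p : ℕ} (u v : Fin p → V) (Ω : Finset (Fin p × Fin p))
  (x : Fin p × Fin p)

/-- The vertices other than `u x.1` whose neighborhoods can cause collisions with the edges at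
`u x.1`. -/
def leftConflicts : Finset V :=
  (insert (v x.2) ((Ω.filter fun y => y.2 = x.2).image fun y => u y.1)).erase (u x.1)

/-- The vertices other than `v x.2` whose neighborhoods can cause collisions with the edges at
`v x.2`. -/
def rightConflicts : Finset V :=
  (insert (u x.1) ((Ω.filter fun y => y.1 = x.1).image fun y => v y.2)).erase (v x.2)

/-- The pairs of vertices from `Ω` that avoid both `u x.1` and `v x.2`. -/
def farPairs : Finset (V × V) :=
  (Ω.image fun y => (u y.1, v y.2)).filter fun z =>
    (z.1 ≠ u x.1 ∧ z.2 ≠ u x.1) ∧ z.1 ≠ v x.2 ∧ z.2 ≠ v x.2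

end

/-- If there are few collisions at each vertex of the product graph, then the product matrix has
the null space property for `Ω`. -/
theorem two_mul_sum_abs_le_of_fewCollisions {V : Type*} [DecidableEq V] {p δ m : ℕ}
    {u v : Fin p → V} (hu : u.Injective) (hv : v.Injective) {Ω : Finset (Fin p × Fin p)}
    {adj : EdgeChoice p δ m → Matrix (Fin m) (Fin p) ℝ} (hadj : IsAdjacency adj)
    (hδ : 16 ≤ δ) {E : V × Fin δ → Fin m}
    (hE : ∀ x : Fin p × Fin p, FewCollisions 64 (u x.1) (v x.2) (leftConflicts u v Ω x)
      (rightConflicts u v Ω x) (farPairs u v Ω x) E)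
    (Z : Matrix (Fin p) (Fin p) ℝ)
    (hZ : adj (fun i k => E (u i, k)) * Z * (adj fun i k => E (v i, k))ᵀ = 0) :
    2 * ∑ x ∈ Ω, |Z x.1 x.2| ≤ ∑ x ∈ Ωᶜ, |Z x.1 x.2| := by
  classical
  set F : EdgeChoice p δ m := fun i k => E (u i, k) with hF
  set G : EdgeChoice p δ m := fun i k => E (v i, k) with hG
  have hδ' : (16 : ℝ) ≤ δ := by exact_mod_cast hδ
  let W : Fin m × Fin m → Fin p × Fin p → ℝ := fun y x => adj F y.1 x.1 * adj G y.2 x.2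
  have hWne : ∀ y x, W y x ≠ 0 ↔ (∃ k, F x.1 k = y.1) ∧ ∃ k, G x.2 k = y.2 := fun y x => by
    simp only [W, mul_ne_zero_iff, hadj.ne_zero_iff]
  let C : Fin p × Fin p → Finset (Fin m × Fin m) := fun x =>
    Finset.univ.filter fun y => ∃ x' ∈ Ω, x' ≠ x ∧ W y x' ≠ 0
  -- As `δ ≥ 16`, the collision count is at most `(4δ² + 64δ) / 64 ≤ δ²/8 = τ`, while the column
  -- mass is at least `(63/64)² δ² ≥ 4τ`.
  refine two_mul_sum_abs_le_of_collision_le W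
    (fun y x => mul_nonneg (hadj.nonneg _ _ _) (hadj.nonneg _ _ _)) Ω C (by simp [C])
    (τ := (δ : ℝ) ^ 2 / 8) (by positivity) ?_ ?_ (fun x => Z x.1 x.2) ?_
  · intro x
    refine (hadj.sum_mul_le_card F G x.1 x.2 (C x)).trans ?_
    have key := (hE x).mul_card_le (C x) ?_
    · have : (64 : ℝ) * ((Finset.univ.filter fun q : Fin δ × Fin δ =>
          (F x.1 q.1, G x.2 q.2) ∈ C x).card : ℝ) ≤ 4 * (δ : ℝ) ^ 2 + 64 * δ := by
        exact_mod_cast key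
      nlinarith
    · intro k k' hk
      simp only [C, Finset.mem_filter, Finset.mem_univ, true_and, hWne] at hk
      obtain ⟨⟨l, l'⟩, hl, hne, h1, h2⟩ := hk
      have h1' : E (u x.1, k) ∈ neighbors E (u l) := mem_neighbors.2 h1
      have h2' : E (v x.2, k') ∈ neighbors E (v l') := mem_neighbors.2 h2
      have hleft : (l' = x.2 ∨ u l = v x.2) → u l ≠ u x.1 →
          k ∈ edgesInto E (u x.1) (leftConflicts u v Ω x) := by
        intro hor hne
        simp only [edgesInto, Finset.mem_filter, Finset.mem_univ, true_and]
        refine ⟨u l, Finset.mem_erase.2 ⟨hne, ?_⟩, h1'⟩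
        rcases hor with h | h
        · exact Finset.mem_insert_of_mem (Finset.mem_image.2 ⟨(l, l'), Finset.mem_filter.2 ⟨hl, h⟩, rfl⟩)
        · rw [h]; exact Finset.mem_insert_self _ _
      have hright : (l = x.1 ∨ v l' = u x.1) → v l' ≠ v x.2 →
          k' ∈ edgesInto E (v x.2) (rightConflicts u v Ω x) := by
        intro hor hne
        simp only [edgesInto, Finset.mem_filter, Finset.mem_univ, true_and]
        refine ⟨v l', Finset.mem_erase.2 ⟨hne, ?_⟩, h2'⟩
        rcases hor with h | h
        · exact Finset.mem_insert_of_mem (Finset.mem_image.2 ⟨(l, l'), Finset.mem_filter.2 ⟨hl, h⟩, rfl⟩)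
        · rw [h]; exact Finset.mem_insert_self _ _
      -- A pair of `Ω` sharing a coordinate with `x`, or having `u l = v x.2` or `v l' = u x.1`, is
      -- charged to a single edge. Any other pair avoids both vertices and belongs to `farPairs`.
      by_cases e1 : l = x.1
      · have e2 : l' ≠ x.2 := fun e2 => hne (by rw [e1, e2])
        exact Or.inr (Or.inl (hright (Or.inl e1) fun h => e2 (hv h)))
      have e1' : u l ≠ u x.1 := fun h => e1 (hu h)
      by_cases e2 : l' = x.2
      · exact Or.inl (hleft (Or.inl e2) e1')
      have e2' : v l' ≠ v x.2 := fun h => e2 (hv h)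
      by_cases e3 : u l = v x.2
      · exact Or.inl (hleft (Or.inr e3) e1')
      by_cases e4 : v l' = u x.1
      · exact Or.inr (Or.inl (hright (Or.inr e4) e2'))
      refine Or.inr (Or.inr (mem_fiber.2 ⟨(u l, v l'), ?_, h1', h2'⟩))
      simp only [farPairs, Finset.mem_filter, Finset.mem_image]
      exact ⟨⟨(l, l'), hl, rfl⟩, ⟨e1', e4⟩, e3, e2'⟩
  · intro x
    have hsum : ∑ y, W y x = (∑ j, adj F j x.1) * ∑ j, adj G j x.2 := by
      rw [Finset.sum_mul_sum, Fintype.sum_prod_type]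
    have hbig : ∀ w, 64 * (δ - (neighbors E w).card) < δ →
        63 / 64 * (δ : ℝ) ≤ ((neighbors E w).card : ℝ) := by
      intro w hw
      have : 63 * δ ≤ 64 * (neighbors E w).card := by omega
      have : (63 : ℝ) * δ ≤ 64 * ((neighbors E w).card : ℝ) := by exact_mod_cast this
      linarith
    have ha := (hbig _ (hE x).left_repeated).trans (hadj.card_image_le F x.1)
    have hb := (hbig _ (hE x).right_repeated).trans (hadj.card_image_le G x.2)
    rw [hsum]
    have := mul_le_mul ha hb (by positivity) (le_trans (by positivity) ha)
    nlinarith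
  · intro y
    rw [← Matrix.mul_mul_transpose_apply_eq_sum, hZ]
    rfl

/-! ### The union bound over all vertices of the product graph -/

theorem card_le_mul_of_mem_distributedSets {d p : ℕ} {Ω : Finset (Fin p × Fin p)}
    (hΩ : Ω ∈ distributedSets d p) : Ω.card ≤ d * p := by
  simp only [distributedSets, Finset.mem_filter, Finset.mem_univ, true_and] at hΩ
  refine (Finset.card_le_mul_card_image (f := Prod.fst) Ω d fun k _ => (hΩ k).1).trans
    (Nat.mul_le_mul_left _ ((Finset.card_le_univ _).trans (by simp)))

/-- Since `d` may exceed `p`, both bounds on `c` are needed: they give `c ≤ 2 min(d, p)`, and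
`min(d, p)² ≤ dp`. -/
theorem mul_card_mul_le_of_card_le {d p δ m K c : ℕ} (hd : 1 ≤ d) (hp : 1 ≤ p) (hcd : c ≤ d + 1)
    (hcp : c ≤ p + 1) (hm : (2 * K * δ) ^ 2 * (d * p) ≤ m ^ 2) : K * (c * δ) ≤ m := by
  have h1 : c ≤ 2 * min d p := by omega
  have h2 : min d p ^ 2 ≤ d * p := by
    rw [sq]; exact Nat.mul_le_mul (min_le_left _ _) (min_le_right _ _)
  have h3 : (K * (c * δ)) ^ 2 ≤ m ^ 2 := by
    calc (K * (c * δ)) ^ 2 ≤ (K * (2 * min d p * δ)) ^ 2 := by gcongr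
      _ = (2 * K * δ) ^ 2 * min d p ^ 2 := by ring
      _ ≤ (2 * K * δ) ^ 2 * (d * p) := Nat.mul_le_mul_left _ h2
      _ ≤ m ^ 2 := hm
  exact (Nat.pow_le_pow_iff_left two_ne_zero).1 h3

/-- With few exceptions, the edge choices have few collisions at all vertices of the product. -/
theorem mul_card_exists_not_fewCollisions_lt {V : Type*} [Fintype V] [DecidableEq V]
    {p d δ m : ℕ} (hp : 1 ≤ p) (hd : 1 ≤ d) (hδ : 5 ≤ δ) (hpδ : p ^ 3 < 2 ^ δ)
    (hm : (2 * 2 ^ (3 * 64) * δ) ^ 2 * (d * p) ≤ m ^ 2)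
    {Ω : Finset (Fin p × Fin p)} (hΩ : Ω ∈ distributedSets d p) (u v : Fin p → V)
    [DecidablePred fun E : V × Fin δ → Fin m => ∃ x : Fin p × Fin p,
      ¬ FewCollisions 64 (u x.1) (v x.2) (leftConflicts u v Ω x)
        (rightConflicts u v Ω x) (farPairs u v Ω x) E] :
    p * (Finset.univ.filter fun E : V × Fin δ → Fin m => ∃ x : Fin p × Fin p,
      ¬ FewCollisions 64 (u x.1) (v x.2) (leftConflicts u v Ω x)
        (rightConflicts u v Ω x) (farPairs u v Ω x) E).card
      < Fintype.card (V × Fin δ → Fin m) := by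
  classical
  have hΩ' := hΩ
  simp only [distributedSets, Finset.mem_filter, Finset.mem_univ, true_and] at hΩ'
  generalize hK : 2 ^ (3 * 64) = K at hm
  have hKpos : 0 < K := hK ▸ by positivity
  -- With `m = 0` there would be no edge choices, and the strict inequality would fail.
  have hmpos : 0 < m := by
    by_contra h
    have : 0 < (2 * K * δ) ^ 2 * (d * p) := by positivity
    have h0 : m = 0 := by omega
    rw [h0] at hm
    simp only [ne_eq, OfNat.ofNat_ne_zero, not_false_eq_true, zero_pow] at hm
    omega
  have : Nonempty (Fin m) := ⟨⟨0, hmpos⟩⟩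
  have hN : 0 < Fintype.card (V × Fin δ → Fin m) := Fintype.card_pos
  set N := Fintype.card (V × Fin δ → Fin m)
  let B : Fin p × Fin p → Finset (V × Fin δ → Fin m) := fun x => Finset.univ.filter fun E =>
    ¬ FewCollisions 64 (u x.1) (v x.2) (leftConflicts u v Ω x)
        (rightConflicts u v Ω x) (farPairs u v Ω x) E
  have hB : ∀ x, 4 ^ δ * (B x).card ≤ (δ + 5) * N := by
    intro x
    have hcol : (Ω.filter fun y => y.2 = x.2).card ≤ p := by
      refine (Finset.card_le_card_of_injOn Prod.fst (t := Finset.univ) (by simp) ?_).trans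
        (by simp)
      rintro ⟨a, b⟩ h1 ⟨a', b'⟩ h2 h
      simp only [Finset.coe_filter, Set.mem_ofPred_eq] at h1 h2 h
      rw [h, h1.2, h2.2]
    have hrow : (Ω.filter fun y => y.1 = x.1).card ≤ p := by
      refine (Finset.card_le_card_of_injOn Prod.snd (t := Finset.univ) (by simp) ?_).trans
        (by simp)
      rintro ⟨a, b⟩ h1 ⟨a', b'⟩ h2 h
      simp only [Finset.coe_filter, Set.mem_ofPred_eq] at h1 h2 h
      rw [h, h1.2, h2.2]
    have hl : (leftConflicts u v Ω x).card ≤ (Ω.filter fun y => y.2 = x.2).card + 1 :=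
      Finset.card_erase_le.trans ((Finset.card_insert_le _ _).trans
        (Nat.add_le_add_right Finset.card_image_le 1))
    have hr : (rightConflicts u v Ω x).card ≤ (Ω.filter fun y => y.1 = x.1).card + 1 :=
      Finset.card_erase_le.trans ((Finset.card_insert_le _ _).trans
        (Nat.add_le_add_right Finset.card_image_le 1))
    have hf : (farPairs u v Ω x).card ≤ d * p :=
      (Finset.card_filter_le _ _).trans
        (Finset.card_image_le.trans (card_le_mul_of_mem_distributedSets hΩ))
    have h1 := (hΩ' x.2).2
    have h2 := (hΩ' x.1).1
    refine four_pow_mul_card_not_fewCollisions_le (La := leftConflicts u v Ω x)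
      (Lb := rightConflicts u v Ω x) (R := farPairs u v Ω x) (Finset.notMem_erase _ _)
      (Finset.notMem_erase _ _) (fun z hz => (Finset.mem_filter.1 hz).2.1)
      (fun z hz => (Finset.mem_filter.1 hz).2.2) ?_ ?_ ?_ ?_ <;> rw [hK]
    · exact mul_card_mul_le_of_card_le hd hp (by omega) (by omega) hm
    · exact mul_card_mul_le_of_card_le hd hp (by omega) (by omega) hm
    · calc K ^ 2 * ((farPairs u v Ω x).card * δ ^ 2) ≤ K ^ 2 * (d * p * δ ^ 2) := by gcongr
        _ ≤ 4 * (K ^ 2 * (d * p * δ ^ 2)) := Nat.le_mul_of_pos_left _ (by norm_num)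
        _ = (2 * K * δ) ^ 2 * (d * p) := by ring
        _ ≤ m ^ 2 := hm
    · simpa using mul_card_mul_le_of_card_le (c := 1) hd hp (by omega) (by omega) hm
  have hsub : (Finset.univ.filter fun E : V × Fin δ → Fin m => ∃ x : Fin p × Fin p,
      ¬ FewCollisions 64 (u x.1) (v x.2) (leftConflicts u v Ω x)
        (rightConflicts u v Ω x) (farPairs u v Ω x) E) ⊆ Finset.univ.biUnion B := by
    intro E hE
    simpa [B] using hE
  set b := (Finset.univ.filter fun E : V × Fin δ → Fin m => ∃ x : Fin p × Fin p,
      ¬ FewCollisions 64 (u x.1) (v x.2) (leftConflicts u v Ω x)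
        (rightConflicts u v Ω x) (farPairs u v Ω x) E).card
  have h5 : ∀ k, 5 ≤ k → k + 5 ≤ 2 ^ k := by
    intro k hk
    induction k, hk using Nat.le_induction with
    | base => norm_num
    | succ k hk ih => rw [pow_succ]; omega
  -- One factor `2^δ` absorbs `δ + 5`. The other leaves the bad proportion at most `p² 2^(-δ)`,
  -- below `1/p` because `p³ < 2^δ`.
  have htot : 2 ^ δ * (2 ^ δ * b) ≤ 2 ^ δ * (p ^ 2 * N) := by
    calc 2 ^ δ * (2 ^ δ * b) = 4 ^ δ * b := by
          rw [← mul_assoc, ← mul_pow]; norm_num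
      _ ≤ 4 ^ δ * ∑ x, (B x).card :=
          Nat.mul_le_mul_left _ ((Finset.card_le_card hsub).trans Finset.card_biUnion_le)
      _ = ∑ x, 4 ^ δ * (B x).card := Finset.mul_sum _ _ _
      _ ≤ ∑ _x : Fin p × Fin p, 2 ^ δ * N :=
          Finset.sum_le_sum fun x _ => (hB x).trans (Nat.mul_le_mul_right _ (h5 δ hδ))
      _ = 2 ^ δ * (p ^ 2 * N) := by simp [Fintype.card_prod]; ring
  have htot := Nat.le_of_mul_le_mul_left htot (by positivity)
  rcases Nat.eq_zero_or_pos b with h0 | hb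
  · rw [h0]; simpa using hN
  · refine Nat.lt_of_mul_lt_mul_left (a := p ^ 2) ?_
    calc p ^ 2 * (p * b) = p ^ 3 * b := by ring
      _ < 2 ^ δ * b := Nat.mul_lt_mul_of_pos_right hpδ hb
      _ ≤ p ^ 2 * N := htot

/-! ### From counting to probability -/

/-- This turns two independent graphs into one uniform choice of edges on two disjoint copies of
`[p]`. -/
theorem uniformOn_univ_prod {α : Type*} [Fintype α] [MeasurableSpace α]
    [MeasurableSingletonClass α] :
    (uniformOn (Set.univ : Set α)).prod (uniformOn (Set.univ : Set α)) =
      uniformOn (Set.univ : Set (α × α)) := by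
  refine Measure.ext_of_singleton fun x => ?_
  rw [← Set.singleton_prod_singleton, Measure.prod_prod, Set.singleton_prod_singleton,
    uniformOn_univ, uniformOn_univ, uniformOn_univ]
  simp only [Measure.count_singleton, Fintype.card_prod, Nat.cast_mul, one_div]
  rw [ENNReal.mul_inv (Or.inr (by simp)) (Or.inl (by simp))]

theorem lt_uniformOn_univ_real_of_mul_card_lt {α β : Type*} [Fintype α] [Fintype β]
    [MeasurableSpace α] [MeasurableSingletonClass α] {p : ℕ} (hp : 0 < p) (e : α ≃ β)
    (P : β → Prop) [DecidablePred P] (hP : p * (Finset.univ.filter P).card < Fintype.card β)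
    (S : Set α) (hS : ∀ a, ¬ P (e a) → a ∈ S) :
    1 - (p : ℝ) ^ (-1 : ℝ) < (uniformOn (Set.univ : Set α)).real S := by
  classical
  have hN : 0 < Fintype.card β := lt_of_le_of_lt (Nat.zero_le _) hP
  have hcard : ((Finset.univ : Finset α).filter fun a => ¬ P (e a)).card +
      (Finset.univ.filter P).card = Fintype.card β := by
    have h1 : (Finset.univ.filter P).card =
        ((Finset.univ : Finset α).filter fun a => P (e a)).card := by
      refine (Finset.card_equiv e fun a => ?_).symm
      simp
    rw [h1, add_comm, Finset.card_filter_add_card_filter_not, Finset.card_univ,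
      Fintype.card_congr e]
  set g := ((Finset.univ : Finset α).filter fun a => ¬ P (e a))
  have hreal : (uniformOn (Set.univ : Set α)).real (g : Set α) = g.card / Fintype.card β := by
    rw [Measure.real, uniformOn_univ, Measure.count_apply_finset, ENNReal.toReal_div,
      ENNReal.toReal_natCast, ENNReal.toReal_natCast, Fintype.card_congr e]
  have hmono : (uniformOn (Set.univ : Set α)).real (g : Set α) ≤
      (uniformOn (Set.univ : Set α)).real S := by
    refine measureReal_mono fun a ha => hS a ?_
    simpa [g] using ha
  refine lt_of_lt_of_le ?_ hmono
  have hp' : (0 : ℝ) < p := by exact_mod_cast hp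
  have hN' : (0 : ℝ) < Fintype.card β := by exact_mod_cast hN
  have h1 : (p : ℝ) * (Finset.univ.filter P).card < Fintype.card β := by exact_mod_cast hP
  have h2 : (g.card : ℝ) + (Finset.univ.filter P).card = Fintype.card β := by
    exact_mod_cast hcard
  rw [hreal, Real.rpow_neg_one, lt_div_iff₀ hN', sub_mul, one_mul]
  have h3 : ((Finset.univ.filter P).card : ℝ) < (p : ℝ)⁻¹ * Fintype.card β := by
    rw [inv_mul_eq_div, lt_div_iff₀ hp', mul_comm]
    exact h1
  linarith

theorem pow_three_lt_two_pow_of_log_le {p δ : ℕ} (hp : 2 ≤ p) (h : 128 * Real.log p ≤ δ) :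
    p ^ 3 < 2 ^ δ := by
  have hp' : (1 : ℝ) < p := by exact_mod_cast hp
  have hlog := Real.log_pos hp'
  have h2 := Real.log_two_gt_d9
  have : Real.log ((p : ℝ) ^ 3) < Real.log ((2 : ℝ) ^ δ) := by
    rw [Real.log_pow, Real.log_pow]
    push_cast
    nlinarith
  have := (Real.log_lt_log_iff (by positivity) (by positivity)).1 this
  exact_mod_cast this

theorem theorem2 :
    ∃ α₀ : ℝ, 0 < α₀ ∧ ∃ c : ℝ, 0 < c ∧ ∃ ε : ℝ, 0 < ε ∧ ε < 1 / 4 ∧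
      ∀ α : ℝ, α₀ ≤ α → ∃ β : ℝ, 0 < β ∧
        ∀ p d δ m : ℕ, 2 ≤ p → 1 ≤ d →
          α₀ * Real.log p ≤ δ → (δ : ℝ) ≤ α * Real.log p →
          β * (Real.sqrt ((d : ℝ) * p) * Real.log p) ≤ m →
          ∀ (X : Matrix (Fin p) (Fin p) ℝ)
            (adj : EdgeChoice p δ m → Matrix (Fin m) (Fin p) ℝ),
            (adj = simpleAdj ∨ adj = multiAdj) →
            1 - (p : ℝ) ^ (-c) < ((edgeLaw p δ m).prod (edgeLaw p δ m)).real
                {E | ApproximatelyRecovers ε d (adj E.1) (adj E.2) X} ∧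
            1 - (p : ℝ) ^ (-c) < (edgeLaw p δ m).real
                {E | ApproximatelyRecovers ε d (adj E) (adj E) X} := by
  classical
  -- The value 128 is generous: it only has to ensure `δ ≥ 16` and `p³ < 2^δ`.
  refine ⟨128, by norm_num, 1, one_pos, 1 / 5, by norm_num, by norm_num, fun α hα => ?_⟩
  -- With `δ ≤ α log p`, this `β` gives `m ≥ 2Kδ√(dp)` for `K = 2^192`; the factor 2 allows for the
  -- extra vertex in the conflict sets.
  refine ⟨2 * 2 ^ (3 * 64) * α, by positivity, ?_⟩
  intro p d δ m hp hd hδl hδu hm X adj hadj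
  have hadj : IsAdjacency adj := by
    rcases hadj with rfl | rfl
    · exact isAdjacency_simpleAdj
    · exact isAdjacency_multiAdj
  have hpδ := pow_three_lt_two_pow_of_log_le hp hδl
  have hδ : 16 ≤ δ := by
    have h1 : Real.log 2 ≤ Real.log p := Real.log_le_log two_pos (by exact_mod_cast hp)
    have h2 := Real.log_two_gt_d9
    have : (16 : ℝ) ≤ δ := by linarith
    exact_mod_cast this
  have hmsq : (2 * 2 ^ (3 * 64) * δ) ^ 2 * (d * p) ≤ m ^ 2 := by
    have hnn : (0 : ℝ) ≤ (d : ℝ) * p := by positivity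
    have h1 : 2 * 2 ^ (3 * 64) * (δ : ℝ) * Real.sqrt ((d : ℝ) * p) ≤ m := by
      refine le_trans ?_ hm
      calc 2 * 2 ^ (3 * 64) * (δ : ℝ) * Real.sqrt ((d : ℝ) * p)
          ≤ 2 * 2 ^ (3 * 64) * (α * Real.log p) * Real.sqrt ((d : ℝ) * p) := by gcongr
        _ = _ := by ring
    have h2 := pow_le_pow_left₀ (by positivity) h1 2
    rw [mul_pow, Real.sq_sqrt hnn] at h2
    exact_mod_cast h2
  obtain ⟨Ω, hΩ, hbest⟩ := Finset.exists_mem_eq_inf' (distributedSets_nonempty d p)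
    fun W => entryNorm (X - restrictTo W X)
  have hp0 : 0 < p := by omega
  constructor
  · have hcount := mul_card_exists_not_fewCollisions_lt hp0 hd (by omega) hpδ hmsq hΩ
      (Sum.inl : Fin p → Fin p ⊕ Fin p) Sum.inr
    rw [edgeLaw, uniformOn_univ_prod]
    refine lt_uniformOn_univ_real_of_mul_card_lt hp0
      ((Equiv.sumArrowEquivProdArrow _ _ _).symm.trans (Equiv.curry _ _ _).symm) _ hcount _ ?_
    intro E hE
    push Not at hE
    exact approximatelyRecovers_of_kernel hbest fun Z hZ =>
      two_mul_sum_abs_le_of_fewCollisions Sum.inl_injective Sum.inr_injective hadj hδ hE Z hZ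
  · have hcount := mul_card_exists_not_fewCollisions_lt hp0 hd (by omega) hpδ hmsq hΩ
      (id : Fin p → Fin p) id
    refine lt_uniformOn_univ_real_of_mul_card_lt hp0 (Equiv.curry _ _ _).symm _ hcount _ ?_
    intro E hE
    push Not at hE
    exact approximatelyRecovers_of_kernel hbest fun Z hZ =>
      two_mul_sum_abs_le_of_fewCollisions Function.injective_id Function.injective_id hadj hδ hE Z
        hZ
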